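/- Let $(P,d,\mu)$ be a metric space with a Borel regular measure $\mu$ such that every open ball has finite positive measure. Assume that $\mu$ is doubling ($\mu(B(x,2r))\le c\,\mu(B(x,r))$ for all $x\in P$, $r>0$, with a constant $c\ge 1$) and non-atomic (every measurable set of positive measure has a measurable subset of strictly smaller positive measure). All functions below are $\mu$-measurable and extended real-valued, and all sets are $\mu$-measurable. Let $X$ be a rearrangement-invariant Banach function space over $(P,\mu)$, i.e. $X=\{u:\|u\|_X<\infty\}$, where $\|\cdot\|_X$ assigns to each measurable function a value in $[0,\infty]$ such that for all measurable $u,v,u_n$: $\|u\|_X=0$ iff $u=0$ a.e.; $\|au\|_X=|a|\,\|u\|_X$ for $a\in\mathbb R$; $\|u+v\|_X\le\|u\|_X+\|v\|_X$; $|u|\le|v|$ a.e. implies $\|u\|_X\le\|v\|_X$; $0\le u_n\uparrow u$ a.e. implies $\|u_n\|_X\uparrow\|u\|_X$; $\|\chi_E\|_X<\infty$ whenever $\mu(E)<\infty$; for each $E$ with $\mu(E)<\infty$ there is $C_E>0$ with $\int_E|u|\,d\mu\le C_E\|u\|_X$ for every $u$; and $\|u\|_X=\|v\|_X$ whenever $\mu(\{|u|>t\})=\mu(\{|v|>t\})$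 for all $t\ge0$. Its fundamental function is $\phi(t)=\|\chi_{E_t}\|_X$ for $0\le t<\mu(P)$, where $E_t$ is any measurable set with $\mu(E_t)=t$, and $\phi(t)=\|1\|_X$ for $t\ge\mu(P)$, $t<\infty$. Let $u^*(t)=\inf\{s\ge0:\mu(\{|u|>s\})\le t\}$ be the decreasing rearrangement of $u$, and let $M^*(X)$ be the weak Marcinkiewicz space of all $u$ with $\|u\|_{M^*(X)}=\sup_{t>0}u^*(t)\phi(t)<\infty$. Write $v\in M^*(X)_{\mathrm{fm}}$ if $v\chi_E\in M^*(X)$ for every $E$ with $\mu(E)<\infty$. For $p\in[1,\infty)$ let $$M_pu(x)=\sup_{B\ni x}\Bigl(\frac1{\mu(B)}\int_B|u|^p\,d\mu\Bigr)^{1/p},$$ the supremum being taken over all open balls $B$ containing $x$. The operator $M_p\colon M^*(X)\to M^*(X)_{\mathrm{fm}}$ is called bounded if it maps $M^*(X)$ into $M^*(X)_{\mathrm{fm}}$ and for every $E\subset P$ with $\mu(E)<\infty$ there is $c_E>0$ such that $\|(M_pu)\chi_E\|_{M^*(X)}\le c_E\|u\|_{M^*(X)}$ for all $u\in M^*(X)$.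 Then, for every $p\in[1,\infty)$, the operator $M_p\colon M^*(X)\to M^*(X)_{\mathrm{fm}}$ is bounded if and only if $$\sup_{0<t<1}\ \phi(t)^p\,\frac1t\int_0^t\frac{ds}{\phi(s)^p}<\infty .$$ -/

import Mathlib

open MeasureTheory Filter Topology Set
open scoped ENNReal NNReal

/-- `u` belongs to the space `X` determined by the functional `N`: it is a `μ`-measurable extended
real-valued function (measurability refers to the completion of `μ`) and `N u` is finite. -/
def MemSpace {P : Type*} [MeasurableSpace P] (μ : Measure P) (N : (P → EReal) → ℝ≥0∞)
    (u : P → EReal) : Prop :=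
  AEMeasurable u μ ∧ N u < ∞

/-- `u ∈ X_fm`: the restrictions of `u` to sets of finite measure belong to `X`. -/
def MemSpaceFm {P : Type*} [MeasurableSpace P] (μ : Measure P) (N : (P → EReal) → ℝ≥0∞)
    (u : P → EReal) : Prop :=
  AEMeasurable u μ ∧
    ∀ E : Set P, NullMeasurableSet E μ → μ E < ∞ → MemSpace μ N (E.indicator u)

/-- Distribution function `μ_f(s) = μ {x : |f x| > s}`. -/
noncomputable def distribFun {P : Type*} [MeasurableSpace P] (μ : Measure P) (f : P → EReal)
    (s : ℝ≥0∞) : ℝ≥0∞ :=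
  μ {x | s < (f x).abs}

/-- Decreasing rearrangement `f^*(t) = inf {s ≥ 0 : μ_f(s) ≤ t}`, with values in `[0, ∞]`
(letting `s = ∞` in the set only encodes the convention `inf ∅ = ∞`). -/
noncomputable def decRearr {P : Type*} [MeasurableSpace P] (μ : Measure P) (f : P → EReal)
    (t : ℝ) : ℝ≥0∞ :=
  sInf {s : ℝ≥0∞ | distribFun μ f s ≤ ENNReal.ofReal t}

/-- Rearrangement-invariant Banach function spaces over `(P, μ)`. The space is
`X = {u : MemSpace μ N u}`, and `N u`, defined for every measurable `u`, is the norm of `u`. -/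
structure IsRISpace {P : Type*} [MeasurableSpace P] (μ : Measure P)
    (N : (P → EReal) → ℝ≥0∞) : Prop where
  eq_zero_iff : ∀ u : P → EReal, AEMeasurable u μ → (N u = 0 ↔ ∀ᵐ x ∂μ, u x = 0)
  smul : ∀ (a : ℝ) (u : P → EReal), AEMeasurable u μ →
    N (fun x => (a : EReal) * u x) = ENNReal.ofReal |a| * N u
  add_le : ∀ u v : P → EReal, AEMeasurable u μ → AEMeasurable v μ →
    N (fun x => u x + v x) ≤ N u + N v
  lattice : ∀ u v : P → EReal, AEMeasurable u μ → AEMeasurable v μ →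
    (∀ᵐ x ∂μ, (u x).abs ≤ (v x).abs) → N u ≤ N v
  fatou : ∀ (u : ℕ → P → EReal) (v : P → EReal), (∀ n, AEMeasurable (u n) μ) →
    AEMeasurable v μ → (∀ᵐ x ∂μ, ∀ n, 0 ≤ u n x) → (∀ᵐ x ∂μ, Monotone fun n => u n x) →
    (∀ᵐ x ∂μ, Tendsto (fun n => u n x) atTop (𝓝 (v x))) →
    Tendsto (fun n => N (u n)) atTop (𝓝 (N v))
  indicator_lt_top : ∀ E : Set P, NullMeasurableSet E μ → μ E < ∞ →
    N (E.indicator fun _ => 1) < ∞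
  locL1 : ∀ E : Set P, NullMeasurableSet E μ → μ E < ∞ →
    ∃ C : ℝ≥0, 0 < C ∧ ∀ u : P → EReal, AEMeasurable u μ →
      ∫⁻ x in E, (u x).abs ∂μ ≤ C * N u
  rearr_inv : ∀ u v : P → EReal, AEMeasurable u μ → AEMeasurable v μ →
    (∀ t : ℝ≥0, distribFun μ u t = distribFun μ v t) → N u = N v

open scoped Classical in
/-- Fundamental function: `φ(t) = N χ_E` for any measurable `E` with `μ E = t` if `t < μ(P)`, and
`φ(t) = N 1` if `t ≥ μ(P)`. In a rearrangement-invariant space all such `E` give the same value, so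
the supremum over `E` is that common value. -/
noncomputable def fundFun {P : Type*} [MeasurableSpace P] (μ : Measure P)
    (N : (P → EReal) → ℝ≥0∞) (t : ℝ) : ℝ≥0∞ :=
  if ENNReal.ofReal t < μ univ then
    ⨆ (E : Set P) (_ : NullMeasurableSet E μ ∧ μ E = ENNReal.ofReal t), N (E.indicator fun _ => 1)
  else N fun _ => 1

/-- The quasi-norm `sup_{t > 0} u^*(t) φ(t)` of the weak Marcinkiewicz space `M^*_φ`. -/
noncomputable def weakMarcinkiewicz {P : Type*} [MeasurableSpace P] (μ : Measure P)
    (φ : ℝ → ℝ≥0∞) (u : P → EReal) : ℝ≥0∞ :=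
  ⨆ (t : ℝ) (_ : 0 < t), decRearr μ u t * φ t

/-- The quasi-norm of `M^*(X)`, where `X` has the norm `N`. -/
noncomputable def weakNorm {P : Type*} [MeasurableSpace P] (μ : Measure P)
    (N : (P → EReal) → ℝ≥0∞) : (P → EReal) → ℝ≥0∞ :=
  weakMarcinkiewicz μ (fundFun μ N)

/-- The non-centered maximal operator `M_p`; the supremum is over all open balls containing `x`. -/
noncomputable def maximalOp {P : Type*} [MetricSpace P] [MeasurableSpace P] (μ : Measure P)
    (p : ℝ) (u : P → EReal) (x : P) : EReal :=
  ((⨆ (y : P) (r : ℝ) (_ : 0 < r ∧ x ∈ Metric.ball y r),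
    (⨍⁻ z in Metric.ball y r, (u z).abs ^ p ∂μ) ^ (1 / p) : ℝ≥0∞) : EReal)

/-- Boundedness of a map `T : X → Y_fm`, where `X` and `Y` have the (quasi-)norms `NX`, `NY`. -/
def IsBoundedFm {P : Type*} [MeasurableSpace P] (μ : Measure P)
    (NX NY : (P → EReal) → ℝ≥0∞) (T : (P → EReal) → P → EReal) : Prop :=
  (∀ u, MemSpace μ NX u → MemSpaceFm μ NY (T u)) ∧
    ∀ E : Set P, NullMeasurableSet E μ → μ E < ∞ →
      ∃ c : ℝ≥0, 0 < c ∧ ∀ u, MemSpace μ NX u → NY (E.indicator (T u)) ≤ c * NX u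

/-- Doubling: `μ(2B) ≤ c μ(B)` for every ball `B`. -/
def IsDoublingMeasure {P : Type*} [MetricSpace P] [MeasurableSpace P] (μ : Measure P) : Prop :=
  ∃ c : ℝ≥0, 1 ≤ c ∧ ∀ (x : P) (r : ℝ), 0 < r →
    μ (Metric.ball x (2 * r)) ≤ c * μ (Metric.ball x r)

/-- Non-atomic measure: every measurable set of positive measure has a measurable subset of
strictly smaller positive measure. -/
def IsNonatomicMeasure {P : Type*} [MeasurableSpace P] (μ : Measure P) : Prop :=
  ∀ A : Set P, MeasurableSet A → 0 < μ A →
    ∃ B : Set P, B ⊆ A ∧ MeasurableSet B ∧ 0 < μ B ∧ μ B < μ A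

/-! ### Metric measure spaces whose balls have finite positive measure -/

/-! Write `φ` for the fundamental function. Both directions compare averages of `|u|^p` over balls
with averages of `(u^*)^p` over intervals `(0, t)`.

Sufficiency rests on `(M_p u)^*(t)^p ≤ C · (1/t) ∫_0^t (u^*)^p`
(`IsDoublingMeasure.exists_decRearr_maximalOp_rpow_le`). To get it, cut `u` at height `u^*(t)`: the
lower part contributes at most `u^*(t)^p` to any average, and the upper part lives on a set of
measure at most `t` and is handled by the weak (1,1) estimate. Since `u^* ≤ ‖u‖ / φ`, the right side
is at most `‖u‖^p` times the average of `φ^(-p)`, and the integral condition bounds `(M_p u)^* φ` on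
`(0, 1)`. After restriction to a set `E` of finite measure, only `t < μ E` matters for `t ≥ 1`,
where monotonicity gives the bound.

Necessity tests the operator on one function. Around a point take balls `B k` of radius `2^(-k)`
with measures `b k`, which tend to `0` because points are null. The function `U = sup_k χ_(B k) / φ
(b k)` has weak norm at most `1`, while on `B j` its maximal function is at least the `L^p` average
of `U` over `B j`. Doubling makes `b k` and `b (k + 1)` comparable, so `φ (2t) ≤ 2 φ t` makes that
average dominate a constant multiple of the average of `φ^(-p)` over `(0, b j)`. Comparability also
carries the bound from the scales `b j` to all `t` in `(0, 1)`.

Basic facts about `φ` need sets of every prescribed measure; these come from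
`exists_subset_measure_eq_of_measure_singleton`. -/

theorem sigmaFinite_of_measure_ball_lt_top {P : Type*} [MetricSpace P] [MeasurableSpace P]
    [BorelSpace P] {μ : Measure P}
    (hfin : ∀ (x : P) (r : ℝ), 0 < r → μ (Metric.ball x r) < ∞) : SigmaFinite μ := by
  rcases isEmpty_or_nonempty P with hP | ⟨⟨x⟩⟩
  · rw [Measure.eq_zero_of_isEmpty μ]; infer_instance
  · refine ⟨⟨⟨fun n : ℕ => Metric.ball x (n + 1), fun _ => trivial,
      fun n => hfin x _ (by positivity), ?_⟩⟩⟩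
    refine eq_univ_of_forall fun y => mem_iUnion.2 ?_
    obtain ⟨n, hn⟩ := exists_nat_gt (dist y x)
    exact ⟨n, Metric.mem_ball.2 (by linarith)⟩

theorem countable_of_pairwiseDisjoint_closedBall {P : Type*} [MetricSpace P] [MeasurableSpace P]
    [BorelSpace P] {μ : Measure P} [SigmaFinite μ]
    (hpos : ∀ (x : P) (r : ℝ), 0 < r → 0 < μ (Metric.ball x r)) {ι : Type*} {u : Set ι}
    {x : ι → P} {r : ι → ℝ} (hr : ∀ i ∈ u, 0 < r i)
    (hu : u.PairwiseDisjoint fun i => Metric.closedBall (x i) (r i)) : u.Countable := by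
  have h := Measure.countable_meas_pos_of_disjoint_iUnion (μ := μ)
    (As := fun i : u => Metric.closedBall (x i) (r i))
    (fun i => Metric.isClosed_closedBall.measurableSet)
    (fun i j hij => hu i.2 j.2 (fun h => hij (Subtype.ext h)))
  have h' : {i : u | 0 < μ (Metric.closedBall (x i) (r i))} = univ :=
    eq_univ_of_forall fun i =>
      (hpos (x i) (r i) (hr i i.2)).trans_le (measure_mono Metric.ball_subset_closedBall)
  rw [h'] at h
  exact countable_coe_iff.1 (countable_univ_iff.1 h)

/-- Disjoint balls of positive measure are countably many by σ-finiteness, so the Vitali covering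
lemma yields a countable `ε`-net for every `ε`. Separability then lets the space be embedded
measurably in `ℝ`. -/
theorem secondCountableTopology_of_measure_ball {P : Type*} [MetricSpace P] [MeasurableSpace P]
    [BorelSpace P] {μ : Measure P} [SigmaFinite μ]
    (hpos : ∀ (x : P) (r : ℝ), 0 < r → 0 < μ (Metric.ball x r)) :
    SecondCountableTopology P := by
  refine Metric.secondCountable_of_almost_dense_set fun ε hε => ?_
  obtain ⟨u, -, hu, hcov⟩ := Vitali.exists_disjoint_subfamily_covering_enlargement_closedBall
    (univ : Set P) id (fun _ => ε / 5) (ε / 5) (fun _ _ => le_rfl) 5 (by norm_num)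
  refine ⟨u, countable_of_pairwiseDisjoint_closedBall (μ := μ) hpos
    (fun _ _ => by positivity) hu, fun x => ?_⟩
  obtain ⟨y, hy, hxy⟩ := hcov x (mem_univ x)
  have := hxy (Metric.mem_closedBall_self (by positivity))
  rw [Metric.mem_closedBall] at this
  exact ⟨y, hy, by simpa [mul_div_cancel₀] using this⟩

theorem IsNonatomicMeasure.measure_singleton {P : Type*} [MeasurableSpace P]
    [MeasurableSingletonClass P] {μ : Measure P} (h : IsNonatomicMeasure μ) (x : P) :
    μ {x} = 0 := by
  by_contra hx
  obtain ⟨B, hB, -, hpos, hlt⟩ := h {x} (measurableSet_singleton x) (pos_iff_ne_zero.2 hx)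
  rcases subset_singleton_iff_eq.1 hB with rfl | rfl
  · simp at hpos
  · exact lt_irrefl _ hlt

/-! ### Intermediate values of nonatomic measures -/

/-- The distribution function of a finite measure without point masses is continuous, so it takes
every intermediate value. The witness is the infimum of the `r` at which it is at least `a`. -/
theorem exists_measure_Iic_eq (ν : Measure ℝ) [IsFiniteMeasure ν] [NullSingletonClass ν] {a : ℝ≥0∞}
    (h0 : a ≠ 0) (ha : a < ν univ) : ∃ r : ℝ, ν (Iic r) = a := by
  have hmono : Monotone fun r => ν (Iic r) := fun r s h => measure_mono (Iic_subset_Iic.2 h)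
  obtain ⟨r₁, hr₁⟩ : ∃ r, a < ν (Iic r) :=
    ((tendsto_measure_Iic_atTop ν).eventually (lt_mem_nhds ha)).exists
  obtain ⟨r₀, hr₀⟩ : ∃ r, ν (Iic r) < a := by
    have h := tendsto_measure_iInter_atBot (μ := ν) (s := fun r : ℝ => Iic r)
      (fun r => measurableSet_Iic.nullMeasurableSet) (fun r s h => Iic_subset_Iic.2 h)
      ⟨0, measure_ne_top _ _⟩
    have he : ⋂ r : ℝ, Iic r = ∅ := by
      refine eq_empty_of_forall_notMem fun x hx => ?_
      have := mem_iInter.1 hx (x - 1)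
      rw [mem_Iic] at this
      linarith
    rw [he, measure_empty] at h
    exact (h.eventually (gt_mem_nhds (pos_iff_ne_zero.2 h0))).exists
  set S : Set ℝ := {r | a ≤ ν (Iic r)} with hS
  have hne : S.Nonempty := ⟨r₁, hr₁.le⟩
  have hbdd : BddBelow S := ⟨r₀, fun r hr => le_of_not_gt fun h =>
    absurd (hr.trans (hmono h.le)) (not_le.2 hr₀)⟩
  have hglb := isGLB_csInf hne hbdd
  refine ⟨sInf S, le_antisymm ?_ ?_⟩
  -- Null points allow replacing `Iic` by `Iio`, which is exhausted from the left by half-lines of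
  -- measure below `a`.
  · rw [← measure_congr (Iio_ae_eq_Iic (μ := ν) (a := sInf S))]
    obtain ⟨v, hv, hlt, hlim⟩ := exists_seq_strictMono_tendsto (sInf S)
    have he : Iio (sInf S) = ⋃ n, Iic (v n) := by
      ext x
      simp only [mem_Iio, mem_iUnion, mem_Iic]
      refine ⟨fun h => ?_, fun ⟨n, hn⟩ => hn.trans_lt (hlt n)⟩
      obtain ⟨n, hn⟩ := (hlim.eventually (lt_mem_nhds h)).exists
      exact ⟨n, hn.le⟩
    rw [he, Monotone.measure_iUnion fun m n h => Iic_subset_Iic.2 (hv.monotone h)]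
    refine iSup_le fun n => le_of_not_ge fun h => ?_
    exact absurd (hglb.1 h) (not_le.2 (hlt n))
  · obtain ⟨v, hv, -, hlim, hmem⟩ := hglb.exists_seq_antitone_tendsto hne
    have he : Iic (sInf S) = ⋂ n, Iic (v n) := by
      ext x
      simp only [mem_iInter, mem_Iic]
      exact ⟨fun h n => h.trans (hglb.1 (hmem n)), fun h => ge_of_tendsto' hlim h⟩
    rw [he, Antitone.measure_iInter (fun m n h => Iic_subset_Iic.2 (hv h))
      (fun n => measurableSet_Iic.nullMeasurableSet) ⟨0, measure_ne_top _ _⟩]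
    exact le_iInf fun n => hmem n

/-- A measurable injection into `ℝ` pushes a finite-measure piece of `E` to a measure without point
masses; pulling back a half-line of the right measure gives `F`. -/
theorem exists_subset_measure_eq_of_measure_singleton {P : Type*} [MeasurableSpace P]
    [MeasurableSpace.CountablySeparated P]
    (μ : Measure P) [SigmaFinite μ] (hsing : ∀ x, μ {x} = 0)
    {E : Set P} (hE : NullMeasurableSet E μ) {a : ℝ≥0∞} (ha : a ≤ μ E) :
    ∃ F ⊆ E, NullMeasurableSet F μ ∧ μ F = a := by
  rcases ha.eq_or_lt with rfl | ha
  · exact ⟨E, Subset.rfl, hE, rfl⟩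
  rcases eq_or_ne a 0 with rfl | h0
  · exact ⟨∅, empty_subset _, nullMeasurableSet_empty, measure_empty⟩
  obtain ⟨n, hn⟩ : ∃ n, a < μ (E ∩ spanningSets μ n) := by
    have h := Monotone.measure_iUnion (μ := μ) (s := fun n => E ∩ spanningSets μ n)
      (fun m n h => inter_subset_inter_right _ (monotone_spanningSets μ h))
    rw [← inter_iUnion, iUnion_spanningSets, inter_univ] at h
    rw [h] at ha
    exact lt_iSup_iff.1 ha
  set G := E ∩ spanningSets μ n
  have hGfin : μ G < ∞ := (measure_mono inter_subset_right).trans_lt (measure_spanningSets_lt_top μ n)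
  have hG : NullMeasurableSet G μ := hE.inter (measurableSet_spanningSets μ n).nullMeasurableSet
  obtain ⟨f, hf, hinj⟩ := MeasurableSpace.measurable_injection_nat_bool_of_countablySeparated P
  obtain ⟨g, hg⟩ := exists_measurableEmbedding_real (ℕ → Bool)
  have hgf : Measurable (g ∘ f) := hg.measurable.comp hf
  have hginj : Function.Injective (g ∘ f) := hg.injective.comp hinj
  have : Fact (μ G < ∞) := ⟨hGfin⟩
  have : NullSingletonClass ((μ.restrict G).map (g ∘ f)) := ⟨fun r => by
    rw [Measure.map_apply hgf (measurableSet_singleton r)]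
    refine nonpos_iff_eq_zero.1 ((Measure.restrict_apply_le _ _).trans ?_)
    rcases (subsingleton_singleton.preimage hginj : ((g ∘ f) ⁻¹' {r}).Subsingleton).eq_empty_or_singleton
      with h | ⟨x, h⟩ <;> simp [h, hsing]⟩
  obtain ⟨r, hr⟩ := exists_measure_Iic_eq ((μ.restrict G).map (g ∘ f)) h0 (by
    rwa [Measure.map_apply hgf .univ, preimage_univ, Measure.restrict_apply_univ])
  rw [Measure.map_apply hgf measurableSet_Iic,
    Measure.restrict_apply (hgf measurableSet_Iic)] at hr
  exact ⟨_, inter_subset_right.trans inter_subset_left,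
    (hgf measurableSet_Iic).nullMeasurableSet.inter hG, hr⟩

/-! ### Comparison of integrals through distribution functions -/

theorem setLIntegral_Ioi_indicator_ofReal_lt (c : ℝ≥0∞) :
    ∫⁻ s in Ioi (0 : ℝ), {s : ℝ | ENNReal.ofReal s < c}.indicator 1 s = c := by
  have hm : MeasurableSet {s : ℝ | ENNReal.ofReal s < c} :=
    measurableSet_lt ENNReal.measurable_ofReal measurable_const
  rw [lintegral_indicator_one hm, Measure.restrict_apply hm]
  rcases eq_or_ne c ∞ with rfl | hc
  · simp
  · have : {s : ℝ | ENNReal.ofReal s < c} ∩ Ioi 0 = Ioo 0 c.toReal := by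
      ext s
      simp only [mem_inter_iff, mem_ofPred_eq, mem_Ioi, mem_Ioo]
      constructor
      · rintro ⟨h, h'⟩; exact ⟨h', (ENNReal.ofReal_lt_iff_lt_toReal h'.le hc).1 h⟩
      · rintro ⟨h', h⟩; exact ⟨(ENNReal.ofReal_lt_iff_lt_toReal h'.le hc).2 h, h'⟩
    rw [this, Real.volume_Ioo, sub_zero, ENNReal.ofReal_toReal hc]

theorem lintegral_eq_lintegral_measure_setOf_lt {α : Type*} [MeasurableSpace α] (μ : Measure α)
    [SigmaFinite μ] {f : α → ℝ≥0∞} (hf : AEMeasurable f μ) :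
    ∫⁻ x, f x ∂μ = ∫⁻ s in Ioi (0 : ℝ), μ {x | ENNReal.ofReal s < f x} := by
  have hms : NullMeasurableSet {q : α × ℝ | ENNReal.ofReal q.2 < f q.1}
      (μ.prod (volume.restrict (Ioi 0))) :=
    nullMeasurableSet_lt (ENNReal.measurable_ofReal.comp measurable_snd).aemeasurable
      hf.comp_fst
  calc ∫⁻ x, f x ∂μ
      = ∫⁻ x, ∫⁻ s in Ioi (0 : ℝ),
          {q : α × ℝ | ENNReal.ofReal q.2 < f q.1}.indicator 1 (x, s) ∂volume ∂μ :=
        lintegral_congr fun x => (setLIntegral_Ioi_indicator_ofReal_lt (f x)).symm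
    _ = ∫⁻ s in Ioi (0 : ℝ), ∫⁻ x,
          {q : α × ℝ | ENNReal.ofReal q.2 < f q.1}.indicator 1 (x, s) ∂μ ∂volume :=
        lintegral_lintegral_swap (f := fun x s =>
          {q : α × ℝ | ENNReal.ofReal q.2 < f q.1}.indicator 1 (x, s)) (aemeasurable_one.indicator₀ hms)
    _ = _ := by
        refine lintegral_congr fun s => ?_
        exact lintegral_indicator_one₀ (s := {x | ENNReal.ofReal s < f x})
          (nullMeasurableSet_lt aemeasurable_const hf)

/-- By the layer-cake formula, integrals depend monotonically on distribution functions. The two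
functions may live on different spaces, so integrals over `P` can be compared with integrals over
intervals. -/
theorem lintegral_le_lintegral_of_measure_setOf_lt_le {α β : Type*} [MeasurableSpace α]
    [MeasurableSpace β] {μ : Measure α} {ν : Measure β} [SigmaFinite μ] [SigmaFinite ν]
    {f : α → ℝ≥0∞} {g : β → ℝ≥0∞} (hf : AEMeasurable f μ) (hg : AEMeasurable g ν)
    (h : ∀ s : ℝ≥0∞, μ {x | s < f x} ≤ ν {y | s < g y}) :
    ∫⁻ x, f x ∂μ ≤ ∫⁻ y, g y ∂ν := by
  rw [lintegral_eq_lintegral_measure_setOf_lt μ hf, lintegral_eq_lintegral_measure_setOf_lt ν hg]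
  exact lintegral_mono fun s => h _

/-! ### The weak type estimate for the maximal operator -/

theorem IsDoublingMeasure.exists_measure_ball_eight_mul_le {P : Type*} [MetricSpace P]
    [MeasurableSpace P] {μ : Measure P} (h : IsDoublingMeasure μ) :
    ∃ C : ℝ≥0, ∀ (x : P) (r : ℝ), 0 < r →
      μ (Metric.ball x (8 * r)) ≤ C * μ (Metric.ball x r) := by
  obtain ⟨c, -, hc⟩ := h
  refine ⟨c * (c * c), fun x r hr => ?_⟩
  calc μ (Metric.ball x (8 * r)) = μ (Metric.ball x (2 * (2 * (2 * r)))) := by ring_nf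
    _ ≤ c * μ (Metric.ball x (2 * (2 * r))) := hc _ _ (by positivity)
    _ ≤ c * (c * μ (Metric.ball x (2 * r))) := by gcongr; exact hc _ _ (by positivity)
    _ ≤ c * (c * (c * μ (Metric.ball x r))) := by gcongr; exact hc _ _ (by positivity)
    _ = _ := by push_cast; ring

/-- Vitali selection: disjoint balls whose enlargements cover the union, each carrying integral at
least `a` times its measure. The factor `8`, three doublings, leaves room to put the closed ball of
radius `5r` inside an open one. The bound `R` on radii is what the selection requires. -/
theorem mul_measure_iUnion_ball_le {P : Type*} [MetricSpace P] [MeasurableSpace P]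
    [BorelSpace P] {μ : Measure P} [SigmaFinite μ]
    (hball : ∀ (x : P) (r : ℝ), 0 < r → 0 < μ (Metric.ball x r) ∧ μ (Metric.ball x r) < ∞)
    {C : ℝ≥0} (hC : ∀ (x : P) (r : ℝ), 0 < r →
      μ (Metric.ball x (8 * r)) ≤ C * μ (Metric.ball x r))
    (g : P → ℝ≥0∞) (a : ℝ≥0∞) (R : ℝ) (t : Set (P × ℝ))
    (ht : ∀ b ∈ t, 0 < b.2 ∧ b.2 ≤ R ∧ a < ⨍⁻ z in Metric.ball b.1 b.2, g z ∂μ) :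
    a * μ (⋃ b ∈ t, Metric.ball b.1 b.2) ≤ C * ∫⁻ z, g z ∂μ := by
  obtain ⟨u, hut, hu, hcov⟩ := Vitali.exists_disjoint_subfamily_covering_enlargement_closedBall
    t Prod.fst Prod.snd R (fun b hb => (ht b hb).2.1) 5 (by norm_num)
  have hcount : u.Countable := countable_of_pairwiseDisjoint_closedBall (μ := μ)
    (fun x r hr => (hball x r hr).1) (fun b hb => (ht b (hut hb)).1) hu
  have hdisj : u.PairwiseDisjoint fun b => Metric.ball b.1 b.2 :=
    hu.mono fun b => Metric.ball_subset_closedBall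
  calc a * μ (⋃ b ∈ t, Metric.ball b.1 b.2)
      ≤ a * μ (⋃ b ∈ u, Metric.ball b.1 (8 * b.2)) := by
        refine mul_le_mul_right (measure_mono ?_) a
        refine iUnion₂_subset fun b hb => ?_
        obtain ⟨b', hb', hsub⟩ := hcov b hb
        refine (Metric.ball_subset_closedBall.trans hsub).trans ?_
        refine (Metric.closedBall_subset_ball ?_).trans
          (subset_iUnion₂ (s := fun (b : P × ℝ) (_ : b ∈ u) => Metric.ball b.1 (8 * b.2)) b' hb')
        have := (ht b' (hut hb')).1
        linarith
    _ ≤ a * ∑' b : u, μ (Metric.ball b.1.1 (8 * b.1.2)) := by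
        gcongr; exact measure_biUnion_le μ hcount _
    _ ≤ a * ∑' b : u, C * μ (Metric.ball b.1.1 b.1.2) := by
        gcongr with b
        exact hC _ _ (ht b (hut b.2)).1
    _ = C * ∑' b : u, a * μ (Metric.ball b.1.1 b.1.2) := by
        rw [ENNReal.tsum_mul_left, ENNReal.tsum_mul_left]; ring
    _ ≤ C * ∑' b : u, ∫⁻ z in Metric.ball b.1.1 b.1.2, g z ∂μ := by
        gcongr with b
        have h := (ht b (hut b.2)).2.2.le
        have hb := hball b.1.1 b.1.2 (ht b (hut b.2)).1
        rw [setLAverage_eq] at h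
        exact (ENNReal.le_div_iff_mul_le (.inl hb.1.ne') (.inl hb.2.ne)).1 h
    _ = C * ∫⁻ z in ⋃ b ∈ u, Metric.ball b.1 b.2, g z ∂μ := by
        rw [lintegral_biUnion hcount (fun b _ => Metric.isOpen_ball.measurableSet) hdisj]
    _ ≤ C * ∫⁻ z, g z ∂μ := by gcongr; exact Measure.restrict_le_self

theorem IsDoublingMeasure.exists_weak_type_one_one {P : Type*} [MetricSpace P]
    [MeasurableSpace P] [BorelSpace P] {μ : Measure P} (hdbl : IsDoublingMeasure μ)
    (hball : ∀ (x : P) (r : ℝ), 0 < r → 0 < μ (Metric.ball x r) ∧ μ (Metric.ball x r) < ∞) :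
    ∃ C : ℝ≥0, ∀ (g : P → ℝ≥0∞) (a : ℝ≥0∞),
      a * μ {x | ∃ (y : P) (r : ℝ), (0 < r ∧ x ∈ Metric.ball y r) ∧
        a < ⨍⁻ z in Metric.ball y r, g z ∂μ} ≤ C * ∫⁻ z, g z ∂μ := by
  have := sigmaFinite_of_measure_ball_lt_top fun x r hr => (hball x r hr).2
  obtain ⟨C, hC⟩ := hdbl.exists_measure_ball_eight_mul_le
  refine ⟨C, fun g a => ?_⟩
  let t (n : ℕ) : Set (P × ℝ) :=
    {b | 0 < b.2 ∧ b.2 ≤ n ∧ a < ⨍⁻ z in Metric.ball b.1 b.2, g z ∂μ}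
  have hsub : {x | ∃ (y : P) (r : ℝ), (0 < r ∧ x ∈ Metric.ball y r) ∧
      a < ⨍⁻ z in Metric.ball y r, g z ∂μ} ⊆ ⋃ n, ⋃ b ∈ t n, Metric.ball b.1 b.2 := by
    rintro x ⟨y, r, ⟨hr, hx⟩, ha⟩
    obtain ⟨n, hn⟩ := exists_nat_ge r
    exact mem_iUnion.2 ⟨n, mem_iUnion₂.2 ⟨(y, r), ⟨hr, hn, ha⟩, hx⟩⟩
  have hmono : Monotone fun n => ⋃ b ∈ t n, Metric.ball b.1 b.2 := fun m n h =>
    biUnion_subset_biUnion_left fun b hb =>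
      ⟨hb.1, hb.2.1.trans (Nat.cast_le.2 h), hb.2.2⟩
  refine (mul_le_mul_right (measure_mono hsub) a).trans ?_
  rw [hmono.measure_iUnion, ENNReal.mul_iSup]
  exact iSup_le fun n => mul_measure_iUnion_ball_le hball hC g a n (t n) fun b hb => hb

/-! ### Decreasing rearrangements -/

theorem abs_indicator_le {P : Type*} (E : Set P) (f : P → EReal) (x : P) :
    (E.indicator f x).abs ≤ (f x).abs := by
  by_cases h : x ∈ E <;> simp [h]

section Rearrangement

variable {P : Type*} [MeasurableSpace P] {μ : Measure P}

theorem distribFun_antitone (f : P → EReal) : Antitone (distribFun μ f) :=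
  fun _ _ h => measure_mono fun _ hx => lt_of_le_of_lt h hx

/-- The infimum defining the rearrangement is attained, by continuity of measure along increasing
superlevel sets. This yields the exact duality `lt_decRearr_iff`. -/
theorem distribFun_decRearr_le (f : P → EReal) (t : ℝ) :
    distribFun μ f (decRearr μ f t) ≤ ENNReal.ofReal t := by
  have hne : {s : ℝ≥0∞ | distribFun μ f s ≤ ENNReal.ofReal t}.Nonempty :=
    ⟨∞, by simp [distribFun]⟩
  obtain ⟨v, hv, -, hlim, hmem⟩ := (isGLB_sInf _).exists_seq_antitone_tendsto hne
  have hsub : {x | decRearr μ f t < (f x).abs} ⊆ ⋃ n, {x | v n < (f x).abs} := fun x hx =>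
    mem_iUnion.2 (hlim.eventually (gt_mem_nhds hx)).exists
  refine (measure_mono hsub).trans ?_
  have hmono : Monotone fun n => {x | v n < (f x).abs} :=
    fun m n h x hx => lt_of_le_of_lt (hv h) hx
  rw [hmono.measure_iUnion]
  exact iSup_le hmem

theorem lt_decRearr_iff {f : P → EReal} {t : ℝ} {s : ℝ≥0∞} :
    s < decRearr μ f t ↔ ENNReal.ofReal t < distribFun μ f s := by
  rw [← not_le, ← not_le, not_iff_not]
  exact ⟨fun h => (distribFun_antitone f h).trans (distribFun_decRearr_le f t), fun h => sInf_le h⟩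

theorem decRearr_le_iff {f : P → EReal} {t : ℝ} {s : ℝ≥0∞} :
    decRearr μ f t ≤ s ↔ distribFun μ f s ≤ ENNReal.ofReal t := by
  rw [← not_lt, ← not_lt, lt_decRearr_iff]

theorem decRearr_antitone (f : P → EReal) : Antitone (decRearr μ f) := fun _ _ h =>
  decRearr_le_iff.2 ((distribFun_decRearr_le f _).trans (ENNReal.ofReal_le_ofReal h))

theorem decRearr_indicator_le (E : Set P) (f : P → EReal) (t : ℝ) :
    decRearr μ (E.indicator f) t ≤ decRearr μ f t :=
  decRearr_le_iff.2 ((measure_mono fun x hx => hx.trans_le (abs_indicator_le E f x)).trans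
    (distribFun_decRearr_le f t))

theorem decRearr_indicator_eq_zero {E : Set P} (f : P → EReal) {t : ℝ}
    (h : μ E ≤ ENNReal.ofReal t) : decRearr μ (E.indicator f) t = 0 := by
  refine nonpos_iff_eq_zero.1 (decRearr_le_iff.2 ((measure_mono fun x hx => ?_).trans h))
  by_contra hE
  simp [hE] at hx

theorem aemeasurable_ereal_abs {f : P → EReal} (hf : AEMeasurable f μ) :
    AEMeasurable (fun x => (f x).abs) μ := by
  have h : Measurable EReal.abs := by
    refine EReal.measurable_of_measurable_real ?_
    exact ENNReal.measurable_ofReal.comp (measurable_norm (α := ℝ))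
  exact h.comp_aemeasurable hf

end Rearrangement

theorem min_le_volume_restrict_Ioo_setOf_ofReal_lt (t : ℝ) (m : ℝ≥0∞) :
    min (ENNReal.ofReal t) m ≤
      volume.restrict (Ioo 0 t) {s : ℝ | ENNReal.ofReal s < m} := by
  have hm : MeasurableSet {s : ℝ | ENNReal.ofReal s < m} :=
    measurableSet_lt ENNReal.measurable_ofReal measurable_const
  rw [Measure.restrict_apply hm]
  rcases le_total (ENNReal.ofReal t) m with h | h
  · rw [min_eq_left h]
    calc ENNReal.ofReal t = volume (Ioo 0 t) := by simp
      _ ≤ _ := measure_mono fun s hs => by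
        exact ⟨((ENNReal.ofReal_lt_ofReal_iff (hs.1.trans hs.2)).2 hs.2).trans_le h, hs⟩
  · rw [min_eq_right h]
    have hfin : m ≠ ∞ := (h.trans_lt ENNReal.ofReal_lt_top).ne
    calc m = volume (Ioo 0 m.toReal) := by simp [ENNReal.ofReal_toReal hfin]
      _ ≤ _ := measure_mono fun s hs => by
        have hs' := (ENNReal.ofReal_lt_iff_lt_toReal hs.1.le hfin).2 hs.2
        refine ⟨hs', hs.1, ?_⟩
        exact (ENNReal.ofReal_lt_ofReal_iff_of_nonneg hs.1.le).1 (hs'.trans_le h)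

/-- Superlevel sets of `f` inside `D` have measure at most `min t (distribFun μ f s)`, which does
not exceed the length of the corresponding superlevel set of `f^*` in `(0, t)`. -/
theorem setLIntegral_abs_rpow_le {P : Type*} [MeasurableSpace P] {μ : Measure P} [SigmaFinite μ]
    {f : P → EReal} (hf : AEMeasurable f μ) {p : ℝ} (hp : 0 < p) {D : Set P} {t : ℝ}
    (hD : μ D ≤ ENNReal.ofReal t) :
    ∫⁻ x in D, (f x).abs ^ p ∂μ ≤ ∫⁻ s in Ioo (0 : ℝ) t, decRearr μ f s ^ p := by
  refine lintegral_le_lintegral_of_measure_setOf_lt_le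
    ((aemeasurable_ereal_abs hf).restrict.pow_const p)
    ((decRearr_antitone f).measurable.pow_const p).aemeasurable fun s => ?_
  have hrpow : ∀ c : ℝ≥0∞, s < c ^ p ↔ s ^ p⁻¹ < c := fun c => by
    rw [← ENNReal.rpow_lt_rpow_iff (inv_pos.2 hp), ENNReal.rpow_rpow_inv hp.ne']
  simp only [hrpow, lt_decRearr_iff]
  refine le_trans (le_min ?_ ?_) (min_le_volume_restrict_Ioo_setOf_ofReal_lt t _)
  · calc _ ≤ μ.restrict D univ := measure_mono (subset_univ _)
      _ ≤ _ := by rwa [Measure.restrict_apply_univ]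
  · exact Measure.restrict_apply_le _ _

/-! ### Fundamental functions of rearrangement-invariant spaces -/

section FundamentalFunction

variable {P : Type*} [MeasurableSpace P] {μ : Measure P} {N : (P → EReal) → ℝ≥0∞}

theorem aemeasurable_indicator_one {E : Set P} (hE : NullMeasurableSet E μ) :
    AEMeasurable (E.indicator fun _ => (1 : EReal)) μ :=
  aemeasurable_const.indicator₀ hE

theorem IsRISpace.indicator_mono (hN : IsRISpace μ N) {E F : Set P}
    (hE : NullMeasurableSet E μ) (hF : NullMeasurableSet F μ) (h : E ⊆ F) :
    N (E.indicator fun _ => 1) ≤ N (F.indicator fun _ => 1) := by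
  refine hN.lattice _ _ (aemeasurable_indicator_one hE) (aemeasurable_indicator_one hF)
    (.of_forall fun x => ?_)
  by_cases hx : x ∈ E
  · simp [hx, h hx]
  · simp [hx]

theorem distribFun_indicator_one (E : Set P) (s : ℝ≥0∞) :
    distribFun μ (E.indicator fun _ => 1) s = if s < 1 then μ E else 0 := by
  have h1 : (1 : EReal).abs = 1 := by
    rw [← EReal.coe_one, EReal.abs_def]; simp
  split_ifs with hs
  · refine congrArg μ (Set.ext fun x => ?_)
    by_cases hx : x ∈ E <;> simp [hx, h1, hs]
  · refine measure_mono_null (fun x hx => hs ?_) (measure_empty (μ := μ))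
    refine lt_of_lt_of_le (hx : s < _) ((abs_indicator_le E _ x).trans h1.le)

theorem IsRISpace.indicator_congr (hN : IsRISpace μ N) {E F : Set P}
    (hE : NullMeasurableSet E μ) (hF : NullMeasurableSet F μ) (h : μ E = μ F) :
    N (E.indicator fun _ => 1) = N (F.indicator fun _ => 1) :=
  hN.rearr_inv _ _ (aemeasurable_indicator_one hE) (aemeasurable_indicator_one hF) fun t => by
    rw [distribFun_indicator_one, distribFun_indicator_one, h]

variable (hN : IsRISpace μ N)
  (hμ : ∀ E : Set P, NullMeasurableSet E μ → ∀ a ≤ μ E, ∃ F ⊆ E, NullMeasurableSet F μ ∧ μ F = a)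

include hN hμ

theorem IsRISpace.indicator_le_fundFun {E : Set P} (hE : NullMeasurableSet E μ) {t : ℝ}
    (h : μ E ≤ ENNReal.ofReal t) : N (E.indicator fun _ => 1) ≤ fundFun μ N t := by
  rw [fundFun]
  split_ifs with ht
  -- Enlarge `E` inside its complement to a set of measure exactly `t`.
  · obtain ⟨F, hFE, hF, hFt⟩ := hμ Eᶜ hE.compl (ENNReal.ofReal t - μ E) (by
      rw [measure_compl₀ hE (h.trans_lt ENNReal.ofReal_lt_top).ne]
      exact tsub_le_tsub_right ht.le _)
    have hm : μ (E ∪ F) = ENNReal.ofReal t := by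
      rw [measure_union₀ hF (disjoint_compl_right.mono_right hFE).aedisjoint, hFt,
        add_tsub_cancel_of_le h]
    exact (hN.indicator_mono hE (hE.union hF) subset_union_left).trans
      (le_iSup₂ (f := fun (E : Set P) (_ : NullMeasurableSet E μ ∧ μ E = ENNReal.ofReal t) =>
        N (E.indicator fun _ => 1)) (E ∪ F) ⟨hE.union hF, hm⟩)
  · exact (hN.indicator_mono hE nullMeasurableSet_univ (subset_univ E)).trans_eq (by rw [indicator_univ])

theorem IsRISpace.exists_fundFun_eq (t : ℝ) :
    ∃ E : Set P, NullMeasurableSet E μ ∧ μ E = min (ENNReal.ofReal t) (μ univ) ∧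
      fundFun μ N t = N (E.indicator fun _ => 1) := by
  rw [fundFun]
  split_ifs with ht
  · obtain ⟨E, -, hE, hEt⟩ := hμ univ nullMeasurableSet_univ _ ht.le
    refine ⟨E, hE, by rw [min_eq_left ht.le, hEt], le_antisymm (iSup₂_le fun F hF => ?_) ?_⟩
    · exact (hN.indicator_congr hF.1 hE (hF.2.trans hEt.symm)).le
    · exact le_iSup₂ (f := fun (E : Set P) (_ : NullMeasurableSet E μ ∧ μ E = ENNReal.ofReal t) =>
        N (E.indicator fun _ => 1)) E ⟨hE, hEt⟩
  · exact ⟨univ, nullMeasurableSet_univ, by rw [min_eq_right (not_lt.1 ht)], by simp⟩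

theorem IsRISpace.fundFun_mono : Monotone (fundFun μ N) := fun s t h => by
  obtain ⟨E, hE, hm, heq⟩ := hN.exists_fundFun_eq hμ s
  rw [heq]
  exact hN.indicator_le_fundFun hμ hE
    (hm.le.trans ((min_le_left _ _).trans (ENNReal.ofReal_le_ofReal h)))

theorem IsRISpace.fundFun_lt_top (t : ℝ) : fundFun μ N t < ∞ := by
  obtain ⟨E, hE, hm, heq⟩ := hN.exists_fundFun_eq hμ t
  rw [heq]
  exact hN.indicator_lt_top E hE
    (hm.le.trans_lt ((min_le_left _ _).trans_lt ENNReal.ofReal_lt_top))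

theorem IsRISpace.fundFun_pos (h0 : 0 < μ univ) {t : ℝ} (ht : 0 < t) : 0 < fundFun μ N t := by
  obtain ⟨E, hE, hm, heq⟩ := hN.exists_fundFun_eq hμ t
  rw [heq, pos_iff_ne_zero, Ne, hN.eq_zero_iff _ (aemeasurable_indicator_one hE)]
  intro h
  have hE0 : μ E = 0 := measure_mono_null (fun x hx => by simp [hx]) h
  rw [hE0] at hm
  exact (lt_min (ENNReal.ofReal_pos.2 ht) h0).ne hm

/-- A set of measure at most `2t` splits into two of measure at most `t`; apply the triangle
inequality to their indicators. -/
theorem IsRISpace.fundFun_two_mul_le {t : ℝ} (ht : 0 ≤ t) :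
    fundFun μ N (2 * t) ≤ 2 * fundFun μ N t := by
  obtain ⟨E, hE, hm, heq⟩ := hN.exists_fundFun_eq hμ (2 * t)
  obtain ⟨F, hFE, hF, hFt⟩ := hμ E hE (min (ENNReal.ofReal t) (μ E)) (min_le_right _ _)
  have hE2 : μ E ≤ ENNReal.ofReal t + ENNReal.ofReal t := by
    rw [← ENNReal.ofReal_add ht ht, ← two_mul]
    exact hm.le.trans (min_le_left _ _)
  have hdiff : μ (E \ F) ≤ ENNReal.ofReal t := by
    rw [measure_sdiff hFE hF (hFt.le.trans_lt
      ((min_le_left _ _).trans_lt ENNReal.ofReal_lt_top)).ne, hFt, tsub_le_iff_right]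
    rcases le_total (ENNReal.ofReal t) (μ E) with h | h
    · rwa [min_eq_left h]
    · rw [min_eq_right h]; exact le_add_self
  have hsum : (E.indicator fun _ => (1 : EReal)) =
      fun x => F.indicator (fun _ => 1) x + (E \ F).indicator (fun _ => 1) x := by
    ext x
    by_cases hx : x ∈ F
    · simp [hx, hFE hx]
    · by_cases hx' : x ∈ E <;> simp [hx, hx']
  rw [heq, hsum, two_mul]
  refine (hN.add_le _ _ (aemeasurable_indicator_one hF)
    (aemeasurable_indicator_one (NullMeasurableSet.diff hE hF))).trans (add_le_add ?_ ?_)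
  · exact hN.indicator_le_fundFun hμ hF (hFt.le.trans (min_le_left _ _))
  · exact hN.indicator_le_fundFun hμ (NullMeasurableSet.diff hE hF) hdiff

theorem IsRISpace.exists_fundFun_mul_le (c : ℝ≥0) :
    ∃ C : ℝ≥0, 0 < C ∧ ∀ t : ℝ, 0 ≤ t → fundFun μ N (c * t) ≤ C * fundFun μ N t := by
  obtain ⟨m, hm⟩ := pow_unbounded_of_one_lt (c : ℝ) one_lt_two
  refine ⟨2 ^ m, by positivity, fun t ht => ?_⟩
  have hpow : ∀ k : ℕ, fundFun μ N (2 ^ k * t) ≤ 2 ^ k * fundFun μ N t := fun k => by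
    induction k with
    | zero => simp
    | succ k ih =>
      calc fundFun μ N (2 ^ (k + 1) * t) = fundFun μ N (2 * (2 ^ k * t)) := by ring_nf
        _ ≤ 2 * fundFun μ N (2 ^ k * t) := hN.fundFun_two_mul_le hμ (by positivity)
        _ ≤ 2 * (2 ^ k * fundFun μ N t) := by gcongr
        _ = _ := by ring
  push_cast
  exact (hN.fundFun_mono hμ (by gcongr)).trans (hpow m)

end FundamentalFunction

/-! ### The rearrangement of the maximal function -/

theorem EReal.abs_coe_ennreal (c : ℝ≥0∞) : (c : EReal).abs = c := by
  induction c with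
  | top => simp
  | coe c =>
    rw [show ((c : ℝ≥0∞) : EReal) = ((c : ℝ) : EReal) from rfl, EReal.abs_def,
      abs_of_nonneg (NNReal.coe_nonneg c), ENNReal.ofReal_coe_nnreal]

theorem decRearr_rpow_le_setLIntegral_div {P : Type*} [MeasurableSpace P] {μ : Measure P}
    {p : ℝ} (hp : 0 ≤ p) (u : P → EReal) {t : ℝ}
    (ht : 0 < t) :
    decRearr μ u t ^ p ≤ (∫⁻ s in Ioo (0 : ℝ) t, decRearr μ u s ^ p) / ENNReal.ofReal t := by
  rw [ENNReal.le_div_iff_mul_le (.inl (ENNReal.ofReal_pos.2 ht).ne') (.inl ENNReal.ofReal_ne_top)]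
  calc decRearr μ u t ^ p * ENNReal.ofReal t = ∫⁻ _ in Ioo (0 : ℝ) t, decRearr μ u t ^ p := by simp
    _ ≤ _ := setLIntegral_mono' measurableSet_Ioo fun s hs =>
      ENNReal.rpow_le_rpow (decRearr_antitone u hs.2.le) hp

section MaximalOperator

variable {P : Type*} [MetricSpace P] [MeasurableSpace P] {μ : Measure P}

theorem lt_abs_maximalOp_iff {p : ℝ} {u : P → EReal} {x : P} {s : ℝ≥0∞} :
    s < (maximalOp μ p u x).abs ↔ ∃ (y : P) (r : ℝ), (0 < r ∧ x ∈ Metric.ball y r) ∧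
      s < (⨍⁻ z in Metric.ball y r, (u z).abs ^ p ∂μ) ^ (1 / p) := by
  rw [maximalOp, EReal.abs_coe_ennreal]
  simp only [lt_iSup_iff, exists_prop]

theorem measurable_maximalOp [BorelSpace P] (p : ℝ) (u : P → EReal) :
    Measurable (maximalOp μ p u) := by
  refine measurable_coe_ennreal_ereal.comp (measurable_of_Ioi fun s => ?_)
  refine IsOpen.measurableSet (isOpen_iff_mem_nhds.2 fun x hx => ?_)
  simp only [mem_preimage, mem_Ioi, lt_iSup_iff, exists_prop] at hx
  obtain ⟨y, r, ⟨hr, hx⟩, hs⟩ := hx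
  filter_upwards [Metric.isOpen_ball.mem_nhds hx] with x' hx'
  simp only [mem_preimage, mem_Ioi, lt_iSup_iff, exists_prop]
  exact ⟨y, r, ⟨hr, hx'⟩, hs⟩

theorem IsDoublingMeasure.exists_decRearr_maximalOp_rpow_le [BorelSpace P]
    (hdbl : IsDoublingMeasure μ)
    (hball : ∀ (x : P) (r : ℝ), 0 < r → 0 < μ (Metric.ball x r) ∧ μ (Metric.ball x r) < ∞)
    {p : ℝ} (hp : 0 < p) :
    ∃ C : ℝ≥0, ∀ u : P → EReal, AEMeasurable u μ → ∀ t : ℝ, 0 < t →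
      decRearr μ (maximalOp μ p u) t ^ p ≤
        C * ((∫⁻ s in Ioo (0 : ℝ) t, decRearr μ u s ^ p) / ENNReal.ofReal t) := by
  have := sigmaFinite_of_measure_ball_lt_top fun x r hr => (hball x r hr).2
  obtain ⟨C₀, hC₀⟩ := hdbl.exists_weak_type_one_one hball
  -- A strictly positive constant is needed so that `C * J` can be cancelled when `I ≠ 0`.
  obtain ⟨C, hC0, hC⟩ : ∃ C : ℝ≥0, 0 < C ∧ C₀ ≤ C := ⟨C₀ + 1, by positivity, by simp⟩
  refine ⟨1 + C, fun u hu t ht => ?_⟩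
  set I := ∫⁻ s in Ioo (0 : ℝ) t, decRearr μ u s ^ p with hI
  set J := I / ENNReal.ofReal t with hJ
  have ht0 : ENNReal.ofReal t ≠ 0 := (ENNReal.ofReal_pos.2 ht).ne'
  rcases eq_or_ne I ∞ with hItop | hItop
  · rw [hJ, hItop, ENNReal.top_div_of_ne_top ENNReal.ofReal_ne_top, ENNReal.mul_top (by simp)]
    exact le_top
  have hJtop : J ≠ ∞ := ENNReal.div_ne_top hItop ht0
  have haJ : decRearr μ u t ^ p ≤ J := decRearr_rpow_le_setLIntegral_div hp.le u ht
  set D := {x | decRearr μ u t < (u x).abs} with hDdef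
  set g := D.indicator fun x => (u x).abs ^ p with hg
  have hgI : ∫⁻ x, g x ∂μ ≤ I := (lintegral_indicator_le _ _).trans
    (setLIntegral_abs_rpow_le hu hp (distribFun_decRearr_le u t))
  have hle : ∀ x, (u x).abs ^ p ≤ decRearr μ u t ^ p + g x := fun x => by
    by_cases hx : x ∈ D
    · rw [hg, indicator_of_mem hx]; exact le_add_self
    · rw [hg, indicator_of_notMem hx, add_zero]
      exact ENNReal.rpow_le_rpow (not_lt.1 hx) hp.le
  rw [← ENNReal.le_rpow_inv_iff hp, decRearr_le_iff]
  -- An average of `|u|^p` above `(1 + C) J` must have an average of `g` above `C J`, since the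
  -- truncated part contributes at most `J`.
  have hsub : {x | (((1 + C : ℝ≥0) : ℝ≥0∞) * J) ^ p⁻¹ < (maximalOp μ p u x).abs} ⊆
      {x | ∃ (y : P) (r : ℝ), (0 < r ∧ x ∈ Metric.ball y r) ∧
        C * J < ⨍⁻ z in Metric.ball y r, g z ∂μ} := by
    intro x hx
    obtain ⟨y, r, hr, hlt⟩ := lt_abs_maximalOp_iff.1 hx
    refine ⟨y, r, hr, ?_⟩
    rw [one_div, ENNReal.rpow_lt_rpow_iff (inv_pos.2 hp)] at hlt
    have hb := hball y r hr.1
    have hav : ⨍⁻ z in Metric.ball y r, (u z).abs ^ p ∂μ ≤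
        J + ⨍⁻ z in Metric.ball y r, g z ∂μ := by
      calc ⨍⁻ z in Metric.ball y r, (u z).abs ^ p ∂μ
          ≤ ⨍⁻ z in Metric.ball y r, (decRearr μ u t ^ p + g z) ∂μ := by
            rw [setLAverage_eq, setLAverage_eq]
            gcongr with z
            exact hle z
        _ = decRearr μ u t ^ p + ⨍⁻ z in Metric.ball y r, g z ∂μ := by
            rw [setLAverage_eq, lintegral_add_left measurable_const, ENNReal.add_div,
              ← setLAverage_eq, ← setLAverage_eq, setLAverage_const hb.1.ne' hb.2.ne]
        _ ≤ _ := by gcongr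
    have h := hlt.trans_le hav
    push_cast at h
    rw [add_mul, one_mul] at h
    exact (ENNReal.add_lt_add_iff_left hJtop).1 h
  refine (measure_mono hsub).trans ?_
  rcases eq_or_ne I 0 with hI0 | hI0
  · refine (measure_mono_null ?_ (measure_empty (μ := μ))).le.trans bot_le
    rintro x ⟨y, r, -, h⟩
    have h0 : ∫⁻ z in Metric.ball y r, g z ∂μ = 0 :=
      nonpos_iff_eq_zero.1 ((setLIntegral_le_lintegral _ _).trans (hgI.trans hI0.le))
    rw [setLAverage_eq, h0, ENNReal.zero_div] at h
    exact absurd h not_lt_zero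
  · have hCJ0 : (C : ℝ≥0∞) * J ≠ 0 :=
      mul_ne_zero (ENNReal.coe_ne_zero.2 hC0.ne') (ENNReal.div_ne_zero.2 ⟨hI0, ENNReal.ofReal_ne_top⟩)
    have hCJ : (C : ℝ≥0∞) * J ≠ ∞ := ENNReal.mul_ne_top ENNReal.coe_ne_top hJtop
    refine (ENNReal.mul_le_mul_iff_right hCJ0 hCJ).1 ((hC₀ g _).trans ?_)
    calc (C₀ : ℝ≥0∞) * ∫⁻ z, g z ∂μ ≤ C * I := by gcongr
      _ = _ := by rw [mul_assoc, hJ, ENNReal.div_mul_cancel ht0 ENNReal.ofReal_ne_top]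

end MaximalOperator

/-! ### Sufficiency of the integral condition -/

theorem decRearr_mul_fundFun_le {P : Type*} [MeasurableSpace P] {μ : Measure P}
    {N : (P → EReal) → ℝ≥0∞} (u : P → EReal) {t : ℝ} (ht : 0 < t) :
    decRearr μ u t * fundFun μ N t ≤ weakNorm μ N u :=
  le_iSup₂ (f := fun (t : ℝ) (_ : 0 < t) => decRearr μ u t * fundFun μ N t) t ht

theorem decRearr_maximalOp_mul_fundFun_le {P : Type*} [MetricSpace P]
    [MeasurableSpace P] {μ : Measure P} {N : (P → EReal) → ℝ≥0∞}
    (hpos : ∀ t : ℝ, 0 < t → 0 < fundFun μ N t) (hfin : ∀ t : ℝ, fundFun μ N t < ∞)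
    (hmono : Monotone (fundFun μ N)) {p : ℝ} (hp : 0 < p) {C : ℝ≥0} {u : P → EReal} {t : ℝ}
    (hC : decRearr μ (maximalOp μ p u) t ^ p ≤
      C * ((∫⁻ s in Ioo (0 : ℝ) t, decRearr μ u s ^ p) / ENNReal.ofReal t)) {K : ℝ≥0∞}
    (hK : fundFun μ N t ^ p * (⨍⁻ s in Ioo (0 : ℝ) t, fundFun μ N s ^ (-p) ∂volume) ≤ K) :
    decRearr μ (maximalOp μ p u) t * fundFun μ N t ≤ (C * K) ^ p⁻¹ * weakNorm μ N u := by
  set A := weakNorm μ N u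
  have hI : ∫⁻ s in Ioo (0 : ℝ) t, decRearr μ u s ^ p ≤
      A ^ p * ∫⁻ s in Ioo (0 : ℝ) t, fundFun μ N s ^ (-p) := by
    rw [← lintegral_const_mul _ (hmono.measurable.pow_const _)]
    refine setLIntegral_mono' measurableSet_Ioo fun s hs => ?_
    rw [ENNReal.rpow_neg, ← ENNReal.inv_rpow, ← ENNReal.mul_rpow_of_nonneg _ _ hp.le]
    refine ENNReal.rpow_le_rpow ?_ hp.le
    rw [← div_eq_mul_inv, ENNReal.le_div_iff_mul_le (.inl (hpos s hs.1).ne') (.inl (hfin s).ne)]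
    exact decRearr_mul_fundFun_le u hs.1
  rw [setLAverage_eq, Real.volume_Ioo, sub_zero] at hK
  have h : (decRearr μ (maximalOp μ p u) t * fundFun μ N t) ^ p ≤ C * K * A ^ p := by
    rw [ENNReal.mul_rpow_of_nonneg _ _ hp.le]
    calc decRearr μ (maximalOp μ p u) t ^ p * fundFun μ N t ^ p
        ≤ C * ((A ^ p * ∫⁻ s in Ioo (0 : ℝ) t, fundFun μ N s ^ (-p)) / ENNReal.ofReal t) *
            fundFun μ N t ^ p := by gcongr; exact hC.trans (by gcongr)
      _ = C * (fundFun μ N t ^ p *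
            ((∫⁻ s in Ioo (0 : ℝ) t, fundFun μ N s ^ (-p)) / ENNReal.ofReal t)) * A ^ p := by
          simp only [div_eq_mul_inv]; ring
      _ ≤ _ := by gcongr
  rw [← ENNReal.le_rpow_inv_iff hp, ENNReal.mul_rpow_of_nonneg _ _ (inv_nonneg.2 hp.le),
    ENNReal.rpow_rpow_inv hp.ne'] at h
  exact h

theorem isBoundedFm_of_forall_indicator_le {P : Type*} [MeasurableSpace P] {μ : Measure P}
    {NX NY : (P → EReal) → ℝ≥0∞} {T : (P → EReal) → P → EReal} (hT : ∀ u, AEMeasurable (T u) μ)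
    (h : ∀ E : Set P, NullMeasurableSet E μ → μ E < ∞ →
      ∃ c : ℝ≥0∞, c < ∞ ∧ ∀ u, MemSpace μ NX u → NY (E.indicator (T u)) ≤ c * NX u) :
    IsBoundedFm μ NX NY T := by
  refine ⟨fun u hu => ⟨hT u, fun E hE hEfin => ⟨(hT u).indicator₀ hE, ?_⟩⟩, fun E hE hEfin => ?_⟩
  · obtain ⟨c, hc, hle⟩ := h E hE hEfin
    exact (hle u hu).trans_lt (ENNReal.mul_lt_top hc hu.2)
  · obtain ⟨c, hc, hle⟩ := h E hE hEfin
    lift c to ℝ≥0 using hc.ne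
    refine ⟨c + 1, by positivity, fun u hu => (hle u hu).trans ?_⟩
    gcongr
    simp

theorem isBoundedFm_maximalOp_of_fundFun {P : Type*} [MetricSpace P] [MeasurableSpace P]
    [BorelSpace P] {μ : Measure P}
    (hball : ∀ (x : P) (r : ℝ), 0 < r → 0 < μ (Metric.ball x r) ∧ μ (Metric.ball x r) < ∞)
    (hdbl : IsDoublingMeasure μ) {N : (P → EReal) → ℝ≥0∞}
    (hpos : ∀ t : ℝ, 0 < t → 0 < fundFun μ N t) (hfin : ∀ t : ℝ, fundFun μ N t < ∞)
    (hmono : Monotone (fundFun μ N)) {p : ℝ} (hp : 0 < p)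
    (hK : (⨆ (t : ℝ) (_ : t ∈ Ioo (0 : ℝ) 1),
        fundFun μ N t ^ p * (⨍⁻ s in Ioo (0 : ℝ) t, fundFun μ N s ^ (-p) ∂volume)) < ∞) :
    IsBoundedFm μ (weakNorm μ N) (weakNorm μ N) (maximalOp μ p) := by
  obtain ⟨C, hC⟩ := hdbl.exists_decRearr_maximalOp_rpow_le hball hp
  set K := ⨆ (t : ℝ) (_ : t ∈ Ioo (0 : ℝ) 1),
        fundFun μ N t ^ p * (⨍⁻ s in Ioo (0 : ℝ) t, fundFun μ N s ^ (-p) ∂volume) with hKdef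
  set L := (C * K) ^ p⁻¹
  have hL : L < ∞ := ENNReal.rpow_lt_top_of_nonneg (inv_nonneg.2 hp.le)
    (ENNReal.mul_lt_top ENNReal.coe_lt_top hK).ne
  have hmain : ∀ u, MemSpace μ (weakNorm μ N) u → ∀ t ∈ Ioo (0 : ℝ) 1,
      decRearr μ (maximalOp μ p u) t * fundFun μ N t ≤ L * weakNorm μ N u := fun u hu t ht =>
    decRearr_maximalOp_mul_fundFun_le hpos hfin hmono hp (hC u hu.1 t ht.1)
      (le_iSup₂ (f := fun (t : ℝ) (_ : t ∈ Ioo (0 : ℝ) 1) =>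
        fundFun μ N t ^ p * (⨍⁻ s in Ioo (0 : ℝ) t, fundFun μ N s ^ (-p) ∂volume)) t ht)
  refine isBoundedFm_of_forall_indicator_le
    (fun u => (measurable_maximalOp p u).aemeasurable) fun E hE hEfin => ?_
  have hh := hpos (1 / 2) (by norm_num)
  -- For `1 ≤ t < μ E`, both factors are controlled by monotonicity: the rearrangement by its value
  -- at `1/2`, a point where `hmain` applies, and `φ` by its value at `μ E`.
  set q := fundFun μ N (μ E).toReal / fundFun μ N (1 / 2) with hq
  have hqfin : q < ∞ := ENNReal.div_lt_top (hfin _).ne hh.ne'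
  refine ⟨L + q * L, ENNReal.add_lt_top.2 ⟨hL, ENNReal.mul_lt_top hqfin hL⟩, fun u hu => ?_⟩
  refine iSup₂_le fun t ht => ?_
  rw [add_mul]
  rcases lt_or_ge t 1 with h1 | h1
  · refine le_trans ?_ le_self_add
    exact (mul_le_mul_left (decRearr_indicator_le _ _ _) _).trans (hmain u hu t ⟨ht, h1⟩)
  rcases le_or_gt (μ E) (ENNReal.ofReal t) with hE' | hE'
  · rw [decRearr_indicator_eq_zero _ hE', zero_mul]; exact bot_le
  · refine le_trans ?_ le_add_self
    have htE : t ≤ (μ E).toReal := ((ENNReal.ofReal_lt_iff_lt_toReal ht.le hEfin.ne).1 hE').le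
    calc decRearr μ (E.indicator (maximalOp μ p u)) t * fundFun μ N t
        ≤ decRearr μ (maximalOp μ p u) (1 / 2) * fundFun μ N (μ E).toReal :=
          mul_le_mul' ((decRearr_indicator_le _ _ _).trans
            (decRearr_antitone _ (by linarith))) (hmono htE)
      _ = q * (decRearr μ (maximalOp μ p u) (1 / 2) * fundFun μ N (1 / 2)) := by
          rw [mul_left_comm, hq, ENNReal.div_mul_cancel hh.ne' (hfin _).ne]
      _ ≤ q * (L * weakNorm μ N u) := by exact mul_le_mul_right (hmain u hu (1 / 2) (by norm_num)) q
      _ = _ := by rw [mul_assoc]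

/-! ### Necessity of the integral condition -/

/-- The largest function that is at most `a k` off `B k` for every `k`. -/
noncomputable def iSupIndicator {α : Type*} (B : ℕ → Set α) (a : ℕ → ℝ≥0∞) (x : α) : ℝ≥0∞ :=
  ⨆ k, (B k).indicator (fun _ => a k) x

theorem setOf_lt_iSupIndicator {α : Type*} (B : ℕ → Set α) (a : ℕ → ℝ≥0∞) (s : ℝ≥0∞) :
    {x | s < iSupIndicator B a x} = ⋃ k ∈ {k | s < a k}, B k := by
  ext x
  simp only [iSupIndicator, mem_ofPred_eq, lt_iSup_iff, mem_iUnion, exists_prop]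
  refine exists_congr fun k => ?_
  by_cases hx : x ∈ B k <;> simp [hx]

theorem measurable_iSupIndicator {α : Type*} [MeasurableSpace α] {B : ℕ → Set α}
    (hB : ∀ k, MeasurableSet (B k)) (a : ℕ → ℝ≥0∞) : Measurable (iSupIndicator B a) :=
  .iSup fun k => measurable_const.indicator (hB k)

theorem measure_biUnion_antitone {α : Type*} [MeasurableSpace α] (ν : Measure α) {B : ℕ → Set α}
    (hB : Antitone B) (T : Set ℕ) : ν (⋃ k ∈ T, B k) = ⨆ k ∈ T, ν (B k) := by
  refine measure_biUnion_eq_iSup T.to_countable fun i hi j hj => ?_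
  rcases le_total i j with h | h
  · exact ⟨i, hi, Subset.rfl, hB h⟩
  · exact ⟨j, hj, hB h, Subset.rfl⟩

section Necessity

variable {P : Type*} [MeasurableSpace P] {μ : Measure P} {B : ℕ → Set P} {b : ℕ → ℝ}

/-- The function exceeds `1 / φ t` only on those `B k` with `φ (b k) < φ t`. Monotonicity forces `b
k ≤ t` there, and a union of nested sets has the supremum of their measures. -/
theorem weakMarcinkiewicz_iSupIndicator_le_one {φ : ℝ → ℝ≥0∞} (hφ : Monotone φ)
    (hB : Antitone B) (hb : ∀ k, μ (B k) = ENNReal.ofReal (b k)) :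
    weakMarcinkiewicz μ φ (fun x => (iSupIndicator B (fun k => (φ (b k))⁻¹) x : EReal)) ≤ 1 := by
  refine iSup₂_le fun t _ => ?_
  refine le_trans (mul_le_mul_left (decRearr_le_iff (s := (φ t)⁻¹).2 ?_) _)
    (ENNReal.inv_mul_le_one _)
  simp only [distribFun, EReal.abs_coe_ennreal]
  rw [setOf_lt_iSupIndicator, measure_biUnion_antitone μ hB]
  refine iSup₂_le fun k hk => ?_
  rw [hb]
  refine ENNReal.ofReal_le_ofReal (le_of_not_gt fun h => ?_)
  exact absurd (hφ h.le) (not_le.2 (ENNReal.inv_lt_inv.1 hk))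

/-- The intervals `(0, b k)` model the nested sets `B k` on the half-line with the same measures;
intersecting levels `k` and `j` gives level `max k j` in both families. -/
theorem setLIntegral_iSupIndicator_Ioo_le [SigmaFinite μ] (hBm : ∀ k, MeasurableSet (B k))
    (hB : Antitone B) (hb : ∀ k, μ (B k) = ENNReal.ofReal (b k)) (hbanti : Antitone b)
    (a : ℕ → ℝ≥0∞) {p : ℝ} (hp : 0 < p) (j : ℕ) :
    ∫⁻ s in Ioo 0 (b j), iSupIndicator (fun k => Ioo 0 (b k)) a s ^ p ≤
      ∫⁻ x in B j, iSupIndicator B a x ^ p ∂μ := by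
  refine lintegral_le_lintegral_of_measure_setOf_lt_le
    ((measurable_iSupIndicator (fun _ => measurableSet_Ioo) a).pow_const p).aemeasurable
    ((measurable_iSupIndicator hBm a).pow_const p).aemeasurable fun s => ?_
  have hrpow : ∀ c : ℝ≥0∞, s < c ^ p ↔ s ^ p⁻¹ < c := fun c => by
    rw [← ENNReal.rpow_lt_rpow_iff (inv_pos.2 hp), ENNReal.rpow_rpow_inv hp.ne']
  simp only [hrpow]
  rw [setOf_lt_iSupIndicator, setOf_lt_iSupIndicator, measure_biUnion_antitone _ hB,
    measure_biUnion_antitone _ fun m n h => Ioo_subset_Ioo_right (hbanti h)]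
  gcongr with k hk
  rw [Measure.restrict_apply measurableSet_Ioo, Measure.restrict_apply (hBm k)]
  calc volume (Ioo 0 (b k) ∩ Ioo 0 (b j)) ≤ volume (Ioo 0 (b (max k j))) := by
        rcases le_total k j with h | h
        · rw [max_eq_right h]; exact measure_mono inter_subset_right
        · rw [max_eq_left h]; exact measure_mono inter_subset_left
    _ = μ (B (max k j)) := by rw [hb, Real.volume_Ioo, sub_zero]
    _ ≤ _ := measure_mono (subset_inter (hB (le_max_left _ _)) (hB (le_max_right _ _)))

end Necessity

theorem exists_succ_le_lt {b : ℕ → ℝ} (hb : Tendsto b atTop (𝓝 0)) {s : ℝ} (hs : 0 < s)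
    (hs0 : s < b 0) : ∃ k, b (k + 1) ≤ s ∧ s < b k := by
  classical
  have hex : ∃ k, b k ≤ s := ((hb.eventually (gt_mem_nhds hs)).exists).imp fun _ h => h.le
  obtain ⟨k, hk⟩ : ∃ k, Nat.find hex = k + 1 := Nat.exists_eq_succ_of_ne_zero fun h =>
    absurd (Nat.find_spec hex) (by rw [h]; exact not_le.2 hs0)
  refine ⟨k, hk ▸ Nat.find_spec hex, not_le.1 (Nat.find_min hex (by omega))⟩

/-- For `b (k + 1) ≤ s < b k`, one has `φ (b k) ≤ φ (c * b (k + 1)) ≤ C * φ s`, so the step function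
is at least `1 / (C * φ s)`. -/
theorem setLIntegral_rpow_neg_le {φ : ℝ → ℝ≥0∞} (hφ : Monotone φ) {c C : ℝ≥0}
    (hC0 : 0 < C) (hC : ∀ t : ℝ, 0 ≤ t → φ (c * t) ≤ C * φ t) {b : ℕ → ℝ} (hbpos : ∀ k, 0 < b k)
    (hbanti : Antitone b) (hbc : ∀ k, b k ≤ c * b (k + 1)) (hb : Tendsto b atTop (𝓝 0))
    {p : ℝ} (hp : 0 < p) (j : ℕ) :
    ∫⁻ s in Ioo 0 (b j), φ s ^ (-p) ≤ (C : ℝ≥0∞) ^ p *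
      ∫⁻ s in Ioo 0 (b j), iSupIndicator (fun k => Ioo 0 (b k)) (fun k => (φ (b k))⁻¹) s ^ p := by
  rw [← lintegral_const_mul _
    ((measurable_iSupIndicator (fun _ => measurableSet_Ioo) _).pow_const p)]
  refine setLIntegral_mono' measurableSet_Ioo fun s hs => ?_
  obtain ⟨k, hk, hk'⟩ := exists_succ_le_lt hb hs.1 (hs.2.trans_le (hbanti j.zero_le))
  rw [ENNReal.rpow_neg, ← ENNReal.inv_rpow, ← ENNReal.mul_rpow_of_nonneg _ _ hp.le]
  refine ENNReal.rpow_le_rpow ?_ hp.le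
  have hφk : φ (b k) ≤ C * φ s :=
    (hφ (hbc k)).trans ((hC _ (hbpos _).le).trans (by gcongr; exact hφ hk))
  calc (φ s)⁻¹ = C * (C * φ s)⁻¹ := by
        rw [ENNReal.mul_inv (.inl (ENNReal.coe_ne_zero.2 hC0.ne')) (.inl ENNReal.coe_ne_top), ← mul_assoc,
          ENNReal.mul_inv_cancel (ENNReal.coe_ne_zero.2 hC0.ne') ENNReal.coe_ne_top, one_mul]
    _ ≤ C * (φ (b k))⁻¹ := by gcongr
    _ ≤ _ := by
        gcongr
        refine le_iSup_of_le k ?_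
        rw [indicator_of_mem (show s ∈ Ioo 0 (b k) from ⟨hs.1, hk'⟩)]

/-- For `t` between consecutive scales, enlarging `(0, t)` to `(0, b k)` costs the factor `c`. For
`b 0 ≤ t < 1`, the integral beyond `b 0` is at most `φ (b 0) ^ (-p)`. -/
theorem iSup_Ioo_average_lt_top {φ : ℝ → ℝ≥0∞} (hφ : Monotone φ)
    (hpos : ∀ t : ℝ, 0 < t → 0 < φ t) (hfin : ∀ t, φ t < ∞) {c : ℝ≥0} {b : ℕ → ℝ}
    (hbpos : ∀ k, 0 < b k) (hbc : ∀ k, b k ≤ c * b (k + 1)) (hb : Tendsto b atTop (𝓝 0))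
    {p : ℝ} (hp : 0 < p) {Q : ℝ≥0∞} (hQ : Q < ∞)
    (h : ∀ (j : ℕ) (t : ℝ), 0 < t → t < b j →
      φ t ^ p * ((∫⁻ s in Ioo 0 (b j), φ s ^ (-p)) / ENNReal.ofReal (b j)) ≤ Q) :
    (⨆ (t : ℝ) (_ : t ∈ Ioo (0 : ℝ) 1),
      φ t ^ p * (⨍⁻ s in Ioo (0 : ℝ) t, φ s ^ (-p) ∂volume)) < ∞ := by
  have hb0 : ENNReal.ofReal (b 0) ≠ 0 := (ENNReal.ofReal_pos.2 (hbpos 0)).ne'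
  set I := ∫⁻ s in Ioo 0 (b 0), φ s ^ (-p)
  -- An infinite integral would contradict the hypothesis at scale `b 0`, tested at the point `b 0 /
  -- 2`.
  have hI : I ≠ ∞ := by
    intro hI
    have h' := h 0 (b 0 / 2) (half_pos (hbpos 0)) (half_lt_self (hbpos 0))
    have hI' : ∫⁻ s in Ioo 0 (b 0), φ s ^ (-p) = ∞ := hI
    rw [hI', ENNReal.top_div_of_ne_top ENNReal.ofReal_ne_top, ENNReal.mul_top
      (ENNReal.rpow_pos (hpos _ (half_pos (hbpos 0))) (hfin _).ne).ne'] at h'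
    exact absurd (h'.trans_lt hQ) (lt_irrefl _)
  have hφ0 : φ (b 0) ^ (-p) ≠ ∞ := by
    rw [ENNReal.rpow_neg]
    exact ENNReal.inv_ne_top.2 (ENNReal.rpow_pos (hpos _ (hbpos 0)) (hfin _).ne).ne'
  have hR : φ 1 ^ p * ((I + φ (b 0) ^ (-p)) / ENNReal.ofReal (b 0)) < ∞ :=
    ENNReal.mul_lt_top (ENNReal.rpow_lt_top_of_nonneg hp.le (hfin 1).ne)
      (ENNReal.div_lt_top (ENNReal.add_ne_top.2 ⟨hI, hφ0⟩) hb0)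
  refine lt_of_le_of_lt (iSup₂_le fun t ht => ?_)
    (max_lt (ENNReal.mul_lt_top (ENNReal.coe_lt_top (r := c)) hQ) hR)
  rw [setLAverage_eq, Real.volume_Ioo, sub_zero]
  rcases lt_or_ge t (b 0) with htb | htb
  · refine le_trans ?_ (le_max_left _ _)
    obtain ⟨k, hk, hk'⟩ := exists_succ_le_lt hb ht.1 htb
    have hinv : (ENNReal.ofReal t)⁻¹ ≤ c * (ENNReal.ofReal (b k))⁻¹ := by
      rw [← div_eq_mul_inv, ENNReal.le_div_iff_mul_le
        (.inl (ENNReal.ofReal_pos.2 (hbpos k)).ne') (.inl ENNReal.ofReal_ne_top), mul_comm,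
        ← div_eq_mul_inv, ENNReal.div_le_iff (ENNReal.ofReal_pos.2 ht.1).ne'
          ENNReal.ofReal_ne_top]
      rw [← ENNReal.ofReal_coe_nnreal (p := c), ← ENNReal.ofReal_mul (NNReal.coe_nonneg c)]
      exact ENNReal.ofReal_le_ofReal ((hbc k).trans (mul_le_mul_of_nonneg_left hk (NNReal.coe_nonneg c)))
    calc φ t ^ p * ((∫⁻ s in Ioo 0 t, φ s ^ (-p)) / ENNReal.ofReal t)
        ≤ φ t ^ p * ((∫⁻ s in Ioo 0 (b k), φ s ^ (-p)) * (c * (ENNReal.ofReal (b k))⁻¹)) := by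
          rw [div_eq_mul_inv]
          gcongr
      _ = c * (φ t ^ p * ((∫⁻ s in Ioo 0 (b k), φ s ^ (-p)) / ENNReal.ofReal (b k))) := by
          rw [div_eq_mul_inv]; ring
      _ ≤ c * Q := by gcongr; exact h k t ht.1 hk'
  · refine le_trans ?_ (le_max_right _ _)
    have hsub : Ioo 0 t ⊆ Ioo 0 (b 0) ∪ Ico (b 0) 1 := fun s hs => by
      rcases lt_or_ge s (b 0) with h | h
      · exact .inl ⟨hs.1, h⟩
      · exact .inr ⟨h, hs.2.trans ht.2⟩
    have hint : ∫⁻ s in Ioo 0 t, φ s ^ (-p) ≤ I + φ (b 0) ^ (-p) := by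
      refine (lintegral_mono_set hsub).trans ((lintegral_union_le _ _ _).trans ?_)
      gcongr
      calc ∫⁻ s in Ico (b 0) 1, φ s ^ (-p) ≤ ∫⁻ _ in Ico (b 0) 1, φ (b 0) ^ (-p) := by
            refine setLIntegral_mono' measurableSet_Ico fun s hs => ?_
            rw [ENNReal.rpow_neg, ENNReal.rpow_neg]
            exact ENNReal.inv_le_inv.2 (ENNReal.rpow_le_rpow (hφ hs.1) hp.le)
        _ = φ (b 0) ^ (-p) * ENNReal.ofReal (1 - b 0) := by simp
        _ ≤ φ (b 0) ^ (-p) * 1 := by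
            gcongr
            rw [ENNReal.ofReal_le_one]
            linarith [hbpos 0]
        _ = _ := mul_one _
    gcongr
    exact hφ ht.2.le

/-- At every point of the ball, that ball competes in the supremum defining the maximal function.
Hence the rearrangement at any `t` below the ball's measure is at least the `L^p` average. -/
theorem average_rpow_mul_le_of_isBoundedFm {P : Type*} [MetricSpace P] [MeasurableSpace P]
    {μ : Measure P} {N : (P → EReal) → ℝ≥0∞} {p : ℝ} (hp : 0 < p)
    {U : P → EReal} (hU : weakNorm μ N U ≤ 1) {A : Set P} {c : ℝ≥0}
    (hc : weakNorm μ N (A.indicator (maximalOp μ p U)) ≤ c * weakNorm μ N U) {y : P} {r : ℝ}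
    (hr : 0 < r) (hA : Metric.ball y r ⊆ A) {t : ℝ} (ht : 0 < t)
    (htr : ENNReal.ofReal t < μ (Metric.ball y r)) :
    fundFun μ N t ^ p * ⨍⁻ z in Metric.ball y r, (U z).abs ^ p ∂μ ≤ (c : ℝ≥0∞) ^ p := by
  have hle : (⨍⁻ z in Metric.ball y r, (U z).abs ^ p ∂μ) ^ (1 / p) ≤
      decRearr μ (A.indicator (maximalOp μ p U)) t := by
    refine le_of_forall_lt fun s hs => lt_decRearr_iff.2 (htr.trans_le (measure_mono ?_))
    intro x hx
    rw [mem_ofPred_eq, indicator_of_mem (hA hx)]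
    exact lt_abs_maximalOp_iff.2 ⟨y, r, ⟨hr, hx⟩, hs⟩
  have h := ((mul_le_mul_left hle _).trans (decRearr_mul_fundFun_le _ ht)).trans
    (hc.trans (mul_le_mul_right hU _))
  rw [mul_one] at h
  have h' := ENNReal.rpow_le_rpow h hp.le
  rwa [ENNReal.mul_rpow_of_nonneg _ _ hp.le, one_div, ENNReal.rpow_inv_rpow hp.ne', mul_comm]
    at h'

theorem iSup_Ioo_average_lt_top_of_isBoundedFm {P : Type*} [MetricSpace P]
    [MeasurableSpace P] [BorelSpace P] {μ : Measure P}
    (hball : ∀ (x : P) (r : ℝ), 0 < r → 0 < μ (Metric.ball x r) ∧ μ (Metric.ball x r) < ∞)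
    (hdbl : IsDoublingMeasure μ) {x₀ : P} (hx₀ : μ {x₀} = 0) {N : (P → EReal) → ℝ≥0∞}
    (hpos : ∀ t : ℝ, 0 < t → 0 < fundFun μ N t) (hfin : ∀ t : ℝ, fundFun μ N t < ∞)
    (hmono : Monotone (fundFun μ N))
    (hmul : ∀ c : ℝ≥0, ∃ C : ℝ≥0, 0 < C ∧ ∀ t : ℝ, 0 ≤ t →
      fundFun μ N (c * t) ≤ C * fundFun μ N t) {p : ℝ} (hp : 0 < p)
    (h : IsBoundedFm μ (weakNorm μ N) (weakNorm μ N) (maximalOp μ p)) :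
    (⨆ (t : ℝ) (_ : t ∈ Ioo (0 : ℝ) 1),
        fundFun μ N t ^ p * (⨍⁻ s in Ioo (0 : ℝ) t, fundFun μ N s ^ (-p) ∂volume)) < ∞ := by
  have := sigmaFinite_of_measure_ball_lt_top fun x r hr => (hball x r hr).2
  obtain ⟨c, -, hc⟩ := hdbl
  obtain ⟨C, hC0, hC⟩ := hmul c
  set B : ℕ → Set P := fun k => Metric.ball x₀ ((1 / 2) ^ k) with hBdef
  have hrpos : ∀ k : ℕ, (0 : ℝ) < (1 / 2) ^ k := fun k => by positivity
  have hBm : ∀ k, MeasurableSet (B k) := fun k => Metric.isOpen_ball.measurableSet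
  have hB : Antitone B := fun m n h => Metric.ball_subset_ball
    (pow_le_pow_of_le_one (by norm_num) (by norm_num) h)
  have hBfin : ∀ k, μ (B k) ≠ ∞ := fun k => (hball _ _ (hrpos k)).2.ne
  set b : ℕ → ℝ := fun k => (μ (B k)).toReal with hbdef
  have hb : ∀ k, μ (B k) = ENNReal.ofReal (b k) := fun k => (ENNReal.ofReal_toReal (hBfin k)).symm
  have hbpos : ∀ k, 0 < b k := fun k =>
    ENNReal.toReal_pos (hball _ _ (hrpos k)).1.ne' (hBfin k)
  have hbanti : Antitone b := fun m n h =>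
    ENNReal.toReal_mono (hBfin m) (measure_mono (hB h))
  have hbc : ∀ k, b k ≤ c * b (k + 1) := fun k => by
    have h := hc x₀ ((1 / 2) ^ (k + 1)) (hrpos _)
    rw [show (2 : ℝ) * (1 / 2) ^ (k + 1) = (1 / 2) ^ k by ring] at h
    have h' := ENNReal.toReal_mono (ENNReal.mul_ne_top ENNReal.coe_ne_top (hBfin (k + 1))) h
    rwa [ENNReal.toReal_mul, ENNReal.coe_toReal] at h'
  have hb0 : Tendsto b atTop (𝓝 0) := by
    have h := tendsto_measure_iInter_atTop (μ := μ) (s := B)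
      (fun k => (hBm k).nullMeasurableSet) hB ⟨0, hBfin 0⟩
    have he : ⋂ k, B k = {x₀} := by
      refine Subset.antisymm (fun x hx => ?_) fun x hx => ?_
      · refine dist_le_zero.1 (ge_of_tendsto' (tendsto_pow_atTop_nhds_zero_of_lt_one
          (r := (1 / 2 : ℝ)) (by norm_num) (by norm_num)) fun k => ?_)
        exact (Metric.mem_ball.1 (mem_iInter.1 hx k)).le
      · rw [mem_singleton_iff.1 hx]
        exact mem_iInter.2 fun k => Metric.mem_ball_self (hrpos k)
    rw [he, hx₀] at h
    exact (ENNReal.tendsto_toReal ENNReal.zero_ne_top).comp h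
  set U : P → EReal := fun x => (iSupIndicator B (fun k => (fundFun μ N (b k))⁻¹) x : EReal)
    with hUdef
  have hU : weakNorm μ N U ≤ 1 := weakMarcinkiewicz_iSupIndicator_le_one hmono hB hb
  have hUm : AEMeasurable U μ :=
    (measurable_coe_ennreal_ereal.comp (measurable_iSupIndicator hBm _)).aemeasurable
  obtain ⟨a, -, ha⟩ := h.2 (B 0) (hBm 0).nullMeasurableSet (hBfin 0).lt_top
  refine iSup_Ioo_average_lt_top hmono hpos hfin hbpos hbc hb0 hp
    (Q := (C : ℝ≥0∞) ^ p * (a : ℝ≥0∞) ^ p) (ENNReal.mul_lt_top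
      (ENNReal.rpow_lt_top_of_nonneg hp.le ENNReal.coe_ne_top)
      (ENNReal.rpow_lt_top_of_nonneg hp.le ENNReal.coe_ne_top)) fun j t ht htj => ?_
  have key := average_rpow_mul_le_of_isBoundedFm hp hU (ha U ⟨hUm, hU.trans_lt ENNReal.one_lt_top⟩)
    (hrpos j) (hB j.zero_le) ht
    ((hb j).symm ▸ (ENNReal.ofReal_lt_ofReal_iff (hbpos j)).2 htj :
      ENNReal.ofReal t < μ (B j))
  have hint := (setLIntegral_rpow_neg_le hmono hC0 hC hbpos hbanti hbc hb0 hp j).trans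
    (mul_le_mul_right (setLIntegral_iSupIndicator_Ioo_le hBm hB hb hbanti _ hp j) _)
  simp only [hUdef, EReal.abs_coe_ennreal, setLAverage_eq] at key
  rw [show Metric.ball x₀ ((1 / 2) ^ j) = B j from rfl, hb] at key
  calc fundFun μ N t ^ p * ((∫⁻ s in Ioo 0 (b j), fundFun μ N s ^ (-p)) / ENNReal.ofReal (b j))
      ≤ fundFun μ N t ^ p * (((C : ℝ≥0∞) ^ p * ∫⁻ x in B j,
          iSupIndicator B (fun k => (fundFun μ N (b k))⁻¹) x ^ p ∂μ) / ENNReal.ofReal (b j)) := by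
        gcongr
    _ = (C : ℝ≥0∞) ^ p * (fundFun μ N t ^ p * ((∫⁻ x in B j,
          iSupIndicator B (fun k => (fundFun μ N (b k))⁻¹) x ^ p ∂μ) / ENNReal.ofReal (b j))) := by
        simp only [div_eq_mul_inv]; ring
    _ ≤ _ := by gcongr

theorem mainTheorem10 {P : Type*} [MetricSpace P] [MeasurableSpace P] [BorelSpace P]
    (μ : Measure P)
    (hball : ∀ (x : P) (r : ℝ), 0 < r → 0 < μ (Metric.ball x r) ∧ μ (Metric.ball x r) < ∞)
    (hdbl : IsDoublingMeasure μ) (hna : IsNonatomicMeasure μ)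
    (N : (P → EReal) → ℝ≥0∞) (hN : IsRISpace μ N) (p : ℝ) (hp : 1 ≤ p) :
    IsBoundedFm μ (weakNorm μ N) (weakNorm μ N) (maximalOp μ p) ↔
      (⨆ (t : ℝ) (_ : t ∈ Ioo (0 : ℝ) 1),
        fundFun μ N t ^ p * (⨍⁻ s in Ioo (0 : ℝ) t, fundFun μ N s ^ (-p) ∂volume)) < ∞ := by
  have hp0 : 0 < p := zero_lt_one.trans_le hp
  have := sigmaFinite_of_measure_ball_lt_top fun x r hr => (hball x r hr).2
  have := secondCountableTopology_of_measure_ball (μ := μ) fun x r hr => (hball x r hr).1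
  have hμ : ∀ E : Set P, NullMeasurableSet E μ → ∀ a ≤ μ E,
      ∃ F ⊆ E, NullMeasurableSet F μ ∧ μ F = a := fun E hE a ha =>
    exists_subset_measure_eq_of_measure_singleton μ hna.measure_singleton hE ha
  have hfin := hN.fundFun_lt_top hμ
  have hmono := hN.fundFun_mono hμ
  rcases isEmpty_or_nonempty P with hP | ⟨⟨x₀⟩⟩
  -- On the empty space `φ` vanishes, and both sides hold because `0 * ∞ = 0`.
  · have hφ : ∀ t, fundFun μ N t = 0 := fun t => by
      obtain ⟨E, hE, -, heq⟩ := hN.exists_fundFun_eq hμ t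
      rw [heq, hN.eq_zero_iff _ (aemeasurable_indicator_one hE)]
      exact .of_forall fun x => (hP.false x).elim
    have hw : ∀ u, weakNorm μ N u = 0 := fun u => by
      simp [weakNorm, weakMarcinkiewicz, hφ]
    refine iff_of_true (isBoundedFm_of_forall_indicator_le
      (fun u => (measurable_maximalOp p u).aemeasurable)
      fun E _ _ => ⟨0, ENNReal.zero_lt_top, fun u _ => by simp [hw]⟩) ?_
    simp [hφ, hp0]
  · have hpos : ∀ t : ℝ, 0 < t → 0 < fundFun μ N t := fun t ht => hN.fundFun_pos hμ
      ((hball x₀ 1 one_pos).1.trans_le (measure_mono (subset_univ _))) ht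
    exact ⟨iSup_Ioo_average_lt_top_of_isBoundedFm hball hdbl (hna.measure_singleton x₀) hpos hfin
        hmono (hN.exists_fundFun_mul_le hμ) hp0,
      isBoundedFm_maximalOp_of_fundFun hball hdbl hpos hfin hmono hp0⟩
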